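/- Let $\mathcal G$ be a finite connected graph, with self-loops and multiple edges allowed, in which every vertex has degree at least $2$ (a self-loop counts twice), and let $p$ be its number of vertices. Let $\Xi:\mathcal T\to\mathcal G$ be the universal cover of $\mathcal G$; it is a tree, and the covering map $\Xi$ takes vertices to vertices and edges to edges. Let real numbers $B_v$ for the vertices $v$ of $\mathcal G$ and strictly positive real numbers $A_\alpha$ for the edges $\alpha$ of $\mathcal G$ be given. The periodic Jacobi matrix $H$ of period $p$ that they define is the bounded self-adjoint operator on $\ell^2(V(\mathcal T))$ with matrix elements $H_{jj}=b_j:=B_{\Xi(j)}$, $H_{jk}=A_{\Xi(\alpha)}$ if $j\neq k$ are the two ends of an edge $\alpha$ of $\mathcal T$, and $H_{jk}=0$ otherwise. If $p$ is odd and $b_j=0$ for all vertices $j$ of $\mathcal T$, then $0\in\operatorname{spec}(H)$. -/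

import Mathlib

open scoped Graph

noncomputable section

namespace PeriodicTree

universe u v w

variable {V : Type u} {E : Type v}

/-- The number of times (`0`, `1` or `2`) that the vertex `x` occurs as an end of the edge `e`
of the multigraph `G`: a self-loop at `x` has `x` as an end twice. -/
def endMult (G : Graph V E) (e : E) (x : V) : ℕ :=
  open Classical in if G.IsLoopAt e x then 2 else if G.Inc e x then 1 else 0

/-- The degree of a vertex of a multigraph, self-loops counted twice. -/
def degree (G : Graph V E) (x : V) : ℕ := ∑ᶠ e : E, endMult G e x

/-- The finite graphs over which periodic Jacobi matrices are built: finite connected multigraphs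
(self-loops and multiple edges allowed) in which every vertex is the end of some edge and
no vertex is a leaf, that is, in which every vertex has degree at least two. -/
structure IsFiniteLeafless (G : Graph V E) : Prop where
  finite_vertexSet : V(G).Finite
  finite_edgeSet : E(G).Finite
  nonempty : V(G).Nonempty
  connected : ∀ x ∈ V(G), ∀ y ∈ V(G), Relation.ReflTransGen G.Adj x y
  two_le_degree : ∀ x ∈ V(G), 2 ≤ degree G x

/-- A universal cover of the multigraph `G` with vertex type `W`: a tree `T` on `W` (a tree has no
self-loops and no multiple edges) with a covering map onto `G`, which takes vertices to vertices
and edges to edges, preserves incidence, and is a local homeomorphism: at each vertex `x` of the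
tree the edges over an edge `e` of `G` are as many as the ends of `e` at the image of `x` (so two
if `e` is a self-loop there). -/
structure UniversalCover (G : Graph V E) (W : Type w) where
  tree : SimpleGraph W
  isTree : tree.IsTree
  proj : W → V
  projEdge : tree.edgeSet → E
  proj_mem : ∀ x, proj x ∈ V(G)
  isLink : ∀ x y (h : tree.Adj x y), G.IsLink (projEdge ⟨s(x, y), h⟩) (proj x) (proj y)
  encard_lifts : ∀ x, ∀ e ∈ E(G),
    {y | ∃ h : tree.Adj x y, projEdge ⟨s(x, y), h⟩ = e}.encard = endMult G e (proj x)

/-- The parameters of a Jacobi matrix on the multigraph `G`: a real number for each vertex and a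
strictly positive real number for each edge (values off the vertex and edge sets play no role). -/
structure JacobiParameters (G : Graph V E) where
  b : V → ℝ
  a : E → ℝ
  a_pos : ∀ e ∈ E(G), 0 < a e

namespace UniversalCover

variable {G : Graph V E} {W : Type w} (T : UniversalCover G W) (J : JacobiParameters G)

/-- The matrix elements of the lift to the universal cover of a Jacobi matrix on `G`: the
parameters of the lift at a vertex or an edge of the tree are those of the image in `G`. -/
def jacobiMatrix (x y : W) : ℝ :=
  open Classical in
  if x = y then J.b (T.proj x)
  else if h : T.tree.Adj x y then J.a (T.projEdge ⟨s(x, y), h⟩) else 0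

theorem jacobiMatrix_comm (x y : W) : T.jacobiMatrix J x y = T.jacobiMatrix J y x := by
  unfold jacobiMatrix
  by_cases hxy : x = y
  · subst hxy; rfl
  · rw [if_neg hxy, if_neg (Ne.symm hxy)]
    by_cases h : T.tree.Adj x y
    · rw [dif_pos h, dif_pos h.symm]
      congr 2
      exact Subtype.ext Sym2.eq_swap
    · rw [dif_neg h, dif_neg (fun h' => h h'.symm)]

theorem projEdge_mem {x y : W} (h : T.tree.Adj x y) : T.projEdge ⟨s(x, y), h⟩ ∈ E(G) :=
  (T.isLink x y h).edge_mem

/-- The vertices `y` for which the matrix element at `(x, y)` may be nonzero. -/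
theorem finite_and_card_le (hG : IsFiniteLeafless G) (x : W) :
    {y | x = y ∨ T.tree.Adj x y}.Finite ∧
      {y | x = y ∨ T.tree.Adj x y}.ncard ≤ 1 + hG.finite_edgeSet.toFinset.card * 2 := by
  classical
  let F : E → Set W := fun e => {y | ∃ h : T.tree.Adj x y, T.projEdge ⟨s(x, y), h⟩ = e}
  have hle : ∀ e ∈ E(G), (F e).encard ≤ 2 := fun e he => by
    rw [T.encard_lifts x e he]
    unfold endMult
    split_ifs <;> norm_num
  have hfin : ∀ e ∈ E(G), (F e).Finite := fun e he =>
    Set.finite_of_encard_le_coe (k := 2) (by simpa using hle e he)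
  have hsub : {y | x = y ∨ T.tree.Adj x y} ⊆
      {x} ∪ ⋃ e ∈ hG.finite_edgeSet.toFinset, F e := by
    rintro y (rfl | h)
    · exact Or.inl rfl
    · refine Or.inr ?_
      simp only [Set.mem_iUnion]
      exact ⟨_, hG.finite_edgeSet.mem_toFinset.2 (T.projEdge_mem h), h, rfl⟩
  have hfinU : ({x} ∪ ⋃ e ∈ hG.finite_edgeSet.toFinset, F e).Finite := by
    refine (Set.finite_singleton x).union ?_
    exact Set.Finite.biUnion (Finset.finite_toSet _)
      (fun e he => hfin e (hG.finite_edgeSet.mem_toFinset.1 he))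
  refine ⟨hfinU.subset hsub, (Set.ncard_le_ncard hsub hfinU).trans ?_⟩
  refine (Set.ncard_union_le _ _).trans ?_
  rw [Set.ncard_singleton]
  gcongr
  refine (Finset.set_ncard_biUnion_le _ _).trans ?_
  refine Finset.sum_le_card_nsmul _ _ 2 (fun e he => ?_)
  have he' := hG.finite_edgeSet.mem_toFinset.1 he
  have := hle e he'
  rw [← (hfin e he').cast_ncard_eq] at this
  exact_mod_cast this

theorem exists_abs_le (hG : IsFiniteLeafless G) :
    ∃ A : ℝ, 0 ≤ A ∧ ∀ x y, |T.jacobiMatrix J x y| ≤ A := by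
  classical
  refine ⟨∑ x ∈ hG.finite_vertexSet.toFinset, |J.b x| +
    ∑ e ∈ hG.finite_edgeSet.toFinset, |J.a e|, by positivity, fun x y => ?_⟩
  unfold jacobiMatrix
  split_ifs with h1 h2
  · have := Finset.single_le_sum (f := fun x => |J.b x|) (fun i _ => abs_nonneg _)
      (hG.finite_vertexSet.mem_toFinset.2 (T.proj_mem x))
    have h0 : 0 ≤ ∑ e ∈ hG.finite_edgeSet.toFinset, |J.a e| := by positivity
    linarith
  · have := Finset.single_le_sum (f := fun e => |J.a e|) (fun i _ => abs_nonneg _)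
      (hG.finite_edgeSet.mem_toFinset.2 (T.projEdge_mem h2))
    have h0 : 0 ≤ ∑ x ∈ hG.finite_vertexSet.toFinset, |J.b x| := by positivity
    linarith
  · simp only [abs_zero]; positivity

/-- The neighbours of `x` together with `x`. -/
def star (hG : IsFiniteLeafless G) (x : W) : Finset W := (T.finite_and_card_le hG x).1.toFinset

theorem mem_star (hG : IsFiniteLeafless G) {x y : W} :
    y ∈ T.star hG x ↔ x = y ∨ T.tree.Adj x y := by
  simp [star]

theorem mem_star_comm (hG : IsFiniteLeafless G) {x y : W} :
    y ∈ T.star hG x ↔ x ∈ T.star hG y := by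
  rw [mem_star, mem_star, eq_comm, T.tree.adj_comm]

theorem card_star_le (hG : IsFiniteLeafless G) (x : W) :
    (T.star hG x).card ≤ 1 + hG.finite_edgeSet.toFinset.card * 2 := by
  rw [star, ← Set.ncard_eq_toFinset_card _ (T.finite_and_card_le hG x).1]
  exact (T.finite_and_card_le hG x).2

/-- The action of the matrix on a function (each row has finitely many nonzero elements). -/
def act (φ : W → ℂ) (x : W) : ℂ := ∑' y, (T.jacobiMatrix J x y : ℂ) * φ y

theorem act_eq_sum (hG : IsFiniteLeafless G) (φ : W → ℂ) (x : W) :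
    T.act J φ x = ∑ y ∈ T.star hG x, (T.jacobiMatrix J x y : ℂ) * φ y := by
  refine tsum_eq_sum (fun y hy => ?_)
  rw [T.mem_star hG, not_or] at hy
  simp [jacobiMatrix, hy.1, hy.2]

theorem exists_bound (hG : IsFiniteLeafless G) :
    ∃ C : ℝ, 0 ≤ C ∧ ∀ (φ : lp (fun _ : W => ℂ) 2) (s : Finset W),
      ∑ x ∈ s, ‖T.act J φ x‖ ^ 2 ≤ (C * ‖φ‖) ^ 2 := by
  classical
  obtain ⟨A, hA, hM⟩ := T.exists_abs_le J hG
  set D : ℝ := ((1 + hG.finite_edgeSet.toFinset.card * 2 : ℕ) : ℝ) with hD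
  have hD0 : 0 ≤ D := Nat.cast_nonneg _
  have hcard : ∀ x, ((T.star hG x).card : ℝ) ≤ D := fun x =>
    Nat.cast_le.2 (T.card_star_le hG x)
  refine ⟨A * D, by positivity, fun φ s => ?_⟩
  have hrow : ∀ x, ‖T.act J φ x‖ ^ 2 ≤ A ^ 2 * D * ∑ y ∈ T.star hG x, ‖φ y‖ ^ 2 := by
    intro x
    have h1 : ‖T.act J φ x‖ ≤ A * ∑ y ∈ T.star hG x, ‖φ y‖ := by
      rw [T.act_eq_sum J hG, Finset.mul_sum]
      refine (norm_sum_le _ _).trans (Finset.sum_le_sum fun y _ => ?_)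
      rw [norm_mul, Complex.norm_real, Real.norm_eq_abs]
      exact mul_le_mul_of_nonneg_right (hM x y) (norm_nonneg _)
    have h2 := sq_sum_le_card_mul_sum_sq (s := T.star hG x) (f := fun y => ‖φ y‖)
    have h3 : 0 ≤ ∑ y ∈ T.star hG x, ‖φ y‖ ^ 2 := Finset.sum_nonneg fun _ _ => sq_nonneg _
    calc ‖T.act J φ x‖ ^ 2 ≤ (A * ∑ y ∈ T.star hG x, ‖φ y‖) ^ 2 := by gcongr
      _ = A ^ 2 * (∑ y ∈ T.star hG x, ‖φ y‖) ^ 2 := by ring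
      _ ≤ A ^ 2 * (D * ∑ y ∈ T.star hG x, ‖φ y‖ ^ 2) := by
          gcongr
          exact h2.trans (mul_le_mul_of_nonneg_right (hcard x) h3)
      _ = _ := by ring
  have hnorm : ∀ t : Finset W, ∑ y ∈ t, ‖φ y‖ ^ 2 ≤ ‖φ‖ ^ 2 := fun t => by
    have := lp.sum_rpow_le_norm_rpow (p := 2) (by norm_num) φ t
    simpa using this
  have hcol : ∑ x ∈ s, ∑ y ∈ T.star hG x, ‖φ y‖ ^ 2 ≤ D * ‖φ‖ ^ 2 := by
    have hswap : ∑ x ∈ s, ∑ y ∈ T.star hG x, ‖φ y‖ ^ 2 =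
        ∑ y ∈ s.biUnion (T.star hG), ∑ x ∈ s.filter (fun x => y ∈ T.star hG x), ‖φ y‖ ^ 2 := by
      refine Finset.sum_comm' (fun x y => ?_)
      simp only [Finset.mem_biUnion, Finset.mem_filter]
      exact ⟨fun h => ⟨h, x, h⟩, fun h => h.1⟩
    rw [hswap]
    calc _ ≤ ∑ y ∈ s.biUnion (T.star hG), D * ‖φ y‖ ^ 2 := by
          refine Finset.sum_le_sum fun y _ => ?_
          rw [Finset.sum_const, nsmul_eq_mul]
          refine mul_le_mul_of_nonneg_right ?_ (sq_nonneg _)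
          refine le_trans ?_ (hcard y)
          exact_mod_cast Finset.card_le_card fun x hx =>
            (T.mem_star_comm hG).1 (Finset.mem_filter.1 hx).2
      _ = D * ∑ y ∈ s.biUnion (T.star hG), ‖φ y‖ ^ 2 := (Finset.mul_sum _ _ _).symm
      _ ≤ _ := mul_le_mul_of_nonneg_left (hnorm _) hD0
  calc ∑ x ∈ s, ‖T.act J φ x‖ ^ 2
      ≤ ∑ x ∈ s, A ^ 2 * D * ∑ y ∈ T.star hG x, ‖φ y‖ ^ 2 := Finset.sum_le_sum fun x _ => hrow x
    _ = A ^ 2 * D * ∑ x ∈ s, ∑ y ∈ T.star hG x, ‖φ y‖ ^ 2 := (Finset.mul_sum _ _ _).symm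
    _ ≤ A ^ 2 * D * (D * ‖φ‖ ^ 2) := mul_le_mul_of_nonneg_left hcol (by positivity)
    _ = _ := by ring

theorem memlp_act (hG : IsFiniteLeafless G) (φ : lp (fun _ : W => ℂ) 2) :
    Memℓp (E := fun _ : W => ℂ) (T.act J φ) 2 := by
  obtain ⟨C, -, h⟩ := T.exists_bound J hG
  refine memℓp_gen' (C := (C * ‖φ‖) ^ 2) fun s => ?_
  simpa using h φ s

/-- The periodic Jacobi matrix over `G` with parameters `J`, as a bounded operator on the Hilbert
space `ℓ²` of the vertices of the universal cover. -/
def jacobiOperator (hG : IsFiniteLeafless G) :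
    lp (fun _ : W => ℂ) 2 →L[ℂ] lp (fun _ : W => ℂ) 2 :=
  LinearMap.mkContinuousOfExistsBound
    { toFun := fun φ => ⟨T.act J φ, T.memlp_act J hG φ⟩
      map_add' := fun φ ψ => by
        ext x
        simp only [lp.coeFn_add, Pi.add_apply]
        simp only [T.act_eq_sum J hG, Pi.add_apply, mul_add, Finset.sum_add_distrib]
      map_smul' := fun c φ => by
        ext x
        simp only [lp.coeFn_smul, Pi.smul_apply, RingHom.id_apply]
        simp only [T.act_eq_sum J hG, Pi.smul_apply, smul_eq_mul, Finset.mul_sum]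
        exact Finset.sum_congr rfl fun y _ => by ring }
    (by
      obtain ⟨C, hC, h⟩ := T.exists_bound J hG
      refine ⟨C, fun φ => ?_⟩
      refine lp.norm_le_of_forall_sum_le (p := 2) (by norm_num) (by positivity) fun s => ?_
      simpa using h φ s)

@[simp] theorem jacobiOperator_apply (hG : IsFiniteLeafless G) (φ : lp (fun _ : W => ℂ) 2)
    (x : W) : T.jacobiOperator J hG φ x = ∑' y, (T.jacobiMatrix J x y : ℂ) * φ y := rfl

end UniversalCover

end PeriodicTree

end

/-!
Suppose that `H` is invertible and let `g_x = H⁻¹ δ_x`. The tree is bipartite and `H` has zero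
diagonal, so `g_x` lives on the class opposite to `x`; in particular `g_x(x) = 0`
(`IsGreenVector.apply_self`). As `(H g_x)(x) = 1`, some neighbour `y` of `x` has `g_x(y) ≠ 0`. Cut
`g_x` off to the branch of the tree beyond the edge from `x` to `y`: since `g_x(x) = 0`, the result
is still a solution of `H φ = c δ_x`, hence a multiple of `g_x`. So `g_x` lives on that branch, and
`y` is the only neighbour of `x` at which `g_x` does not vanish (`IsGreenVector.adj_unique`). As
`H` is self-adjoint, `g_x(y) ≠ 0` is symmetric in `x` and `y`: the edges at which `H⁻¹` does not
vanish form a perfect matching of the tree.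

The matching is invariant under the automorphisms of the tree that preserve edge labels, and these
take a given directed edge to any other with the same label and the same initial fibre
(`exists_automorphism`). So the matching descends to an involution of the vertices of the base
graph. It has no fixed point: a fixed point would be a vertex with a loop whose lifts belong to the
matching, but a vertex of the tree is an end of two lifts of such a loop. Hence the number of
vertices of the base graph is even (`even_ncard_of_isUnit`).
-/

namespace PeriodicTree

universe u v w

variable {V : Type u} {E : Type v}

/-! ### Parents in a rooted tree -/

/-- In a tree rooted at `x`, a vertex other than the root has exactly one neighbour closer to the
root. -/
theorem exists_parent {W : Type*} {t : SimpleGraph W} (ht : t.IsTree) (x w : W) (hw : w ≠ x) :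
    ∃ p, t.Adj p w ∧ t.dist x w = t.dist x p + 1 ∧
      ∀ q, t.Adj q w → t.dist x w = t.dist x q + 1 → q = p := by
  have key : ∀ q, t.Adj q w → t.dist x w = t.dist x q + 1 →
      ∃ P : t.Walk x w, P.IsPath ∧ P.penultimate = q := by
    intro q hq hd
    obtain ⟨P, hP⟩ := ht.connected.exists_walk_length_eq_dist x q
    refine ⟨P.concat hq, ?_, by simp⟩
    apply SimpleGraph.Walk.isPath_of_length_eq_dist
    rw [SimpleGraph.Walk.length_concat, hP, hd]
  obtain ⟨P, hP⟩ := ht.connected.exists_walk_length_eq_dist x w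
  have hnil : ¬ P.Nil := fun h => hw h.eq.symm
  have hadj := P.adj_penultimate hnil
  have hd : t.dist x w = t.dist x P.penultimate + 1 := by
    rcases ht.dist_eq_dist_add_one_of_adj x hadj with h | h
    · have h1 := t.dist_le P.dropLast
      have h2 := SimpleGraph.Walk.length_dropLast_add_one hnil
      omega
    · exact h
  refine ⟨P.penultimate, hadj, hd, fun q hq hqd => ?_⟩
  obtain ⟨P₁, h₁, rfl⟩ := key q hq hqd
  rw [(ht.existsUnique_path x w).unique h₁ (SimpleGraph.Walk.isPath_of_length_eq_dist _ hP)]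

namespace UniversalCover

variable {G : Graph V E} {W : Type w} (T : UniversalCover G W)

/-! ### Label-preserving automorphisms of the universal cover -/

/-- `x` and `y` are the ends of an edge of the tree lying over the edge `e` of the base graph. -/
def Lifts (e : E) (x y : W) : Prop := ∃ h : T.tree.Adj x y, T.projEdge ⟨s(x, y), h⟩ = e

variable {T}

theorem Lifts.adj {e : E} {x y : W} (h : T.Lifts e x y) : T.tree.Adj x y := h.1

theorem Lifts.symm {e : E} {x y : W} (h : T.Lifts e x y) : T.Lifts e y x := by
  obtain ⟨h, rfl⟩ := h
  exact ⟨h.symm, congrArg T.projEdge (Subtype.ext Sym2.eq_swap)⟩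

theorem Lifts.isLink {e : E} {x y : W} (h : T.Lifts e x y) :
    G.IsLink e (T.proj x) (T.proj y) := by
  obtain ⟨h, rfl⟩ := h
  exact T.isLink x y h

theorem exists_lifts {x y : W} (h : T.tree.Adj x y) : ∃ e, T.Lifts e x y := ⟨_, h, rfl⟩

theorem Lifts.unique {e e' : E} {x y : W} (h : T.Lifts e x y) (h' : T.Lifts e' x y) : e = e' := by
  obtain ⟨h, rfl⟩ := h
  obtain ⟨_, rfl⟩ := h'
  rfl

theorem Lifts.proj_eq {e : E} {x y x' y' : W} (h : T.Lifts e x y) (h' : T.Lifts e x' y')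
    (hx : T.proj x = T.proj x') : T.proj y = T.proj y' := by
  have := h'.isLink
  rw [← hx] at this
  exact h.isLink.right_unique this

theorem encard_setOf_lifts (x : W) {e : E} (he : e ∈ E(G)) :
    {y | T.Lifts e x y}.encard = endMult G e (T.proj x) := T.encard_lifts x e he

theorem finite_setOf_lifts (x : W) (e : E) : {y | T.Lifts e x y}.Finite := by
  by_cases he : e ∈ E(G)
  · exact Set.finite_of_encard_eq_coe (T.encard_lifts x e he)
  · convert Set.finite_empty
    ext y
    simpa using fun h : T.Lifts e x y => he h.isLink.edge_mem

/-- The star of `w` is mapped bijectively onto the star of another vertex of the same fibre, edge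
labels being preserved; one edge and its image may be prescribed. -/
theorem exists_star_bijOn (w w' u u' : W) (hw : T.proj w = T.proj w')
    (hu : ∃ e, T.Lifts e w u ∧ T.Lifts e w' u') :
    ∃ f : W → W, Set.BijOn f {v | T.tree.Adj w v} {v | T.tree.Adj w' v} ∧ f u = u' ∧
      ∀ v c, T.Lifts c w v → T.Lifts c w' (f v) := by
  classical
  obtain ⟨e, heu, heu'⟩ := hu
  have key : ∀ c, ∃ f : W → W, Set.BijOn f {v | T.Lifts c w v} {v | T.Lifts c w' v} ∧
      (c = e → f u = u') := by
    intro c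
    have hcard : {v | T.Lifts c w v}.encard = {v | T.Lifts c w' v}.encard := by
      by_cases hc : c ∈ E(G)
      · rw [encard_setOf_lifts w hc, encard_setOf_lifts w' hc, hw]
      · have : ∀ z, {v | T.Lifts c z v} = ∅ := fun z => by
          ext y
          simpa using fun h : T.Lifts c z y => hc h.isLink.edge_mem
        rw [this, this]
    have : Nonempty W := ⟨w⟩
    obtain ⟨f, hf⟩ := (finite_setOf_lifts w c).exists_bijOn_of_encard_eq hcard
    by_cases hc : c = e
    · subst hc
      refine ⟨Equiv.swap (f u) u' ∘ f, Set.BijOn.comp ?_ hf, fun _ => by simp⟩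
      exact (Equiv.swap_bijOn_self (by
        simp only [Set.mem_ofPred_eq, heu', iff_true]
        exact hf.mapsTo heu))
    · exact ⟨f, hf, fun h => absurd h hc⟩
  choose F hF hFe using key
  let lab : W → E := fun v => if h : T.tree.Adj w v then T.projEdge ⟨s(w, v), h⟩ else e
  have hlab : ∀ v c, T.Lifts c w v → lab v = c := by
    rintro v c ⟨h, rfl⟩
    simp only [lab, dif_pos h]
  have hlift : ∀ v c, T.Lifts c w v → T.Lifts c w' (F (lab v) v) := fun v c h => by
    rw [hlab v c h]
    exact (hF c).mapsTo h
  refine ⟨fun v => F (lab v) v, ⟨?_, ?_, ?_⟩, ?_, hlift⟩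
  · intro v hv
    obtain ⟨c, hc⟩ := exists_lifts hv
    exact (hlift v c hc).adj
  · intro v hv v' hv' h
    obtain ⟨c, hc⟩ := exists_lifts hv
    obtain ⟨c', hc'⟩ := exists_lifts hv'
    have h1 := hlift v c hc
    have h2 := hlift v' c' hc'
    simp only at h
    rw [h] at h1
    obtain rfl := h1.unique h2
    rw [hlab v c hc, hlab v' c hc'] at h
    exact (hF c).injOn hc hc' h
  · intro v' hv'
    obtain ⟨c, hc⟩ := exists_lifts hv'
    obtain ⟨v, hv, rfl⟩ := (hF c).surjOn hc
    exact ⟨v, hv.adj, by simp only [hlab v c hv]⟩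
  · simp only [hlab u e heu]
    exact hFe e rfl

/-- The recursion that extends a map of stars along a rooted tree: `par` is the parent map for the
root `x`, `x'` is the image of `x`, the neighbour `y` of `x` is to be sent to `y'`, and
`F a a' u u'` maps the star of `a` to the star of `a'`, taking `u` to `u'`. The map at a vertex at
distance `n` from the root is `propagate F par x x' y y' n`. -/
def propagate (F : W → W → W → W → W → W) (par : W → W) (x x' y y' : W) : ℕ → W → W
  | 0, _ => x'
  | 1, w => F x x' y y' w
  | n + 2, w => F (par w) (propagate F par x x' y y' (n + 1) (par w)) (par (par w))
      (propagate F par x x' y y' n (par (par w))) w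

/-- The universal cover has a label-preserving self-embedding, bijective on stars, that takes a
given directed edge to any directed edge with the same label starting in the same fibre. -/
theorem exists_automorphism {e : E} {x y x' y' : W} (hx : T.proj x = T.proj x')
    (hxy : T.Lifts e x y) (hxy' : T.Lifts e x' y') :
    ∃ σ : W → W, Function.Injective σ ∧ σ x = x' ∧ σ y = y' ∧
      (∀ a, T.proj a = T.proj (σ a)) ∧
      (∀ a, Set.BijOn σ {v | T.tree.Adj a v} {v | T.tree.Adj (σ a) v}) ∧
      ∀ a v c, T.Lifts c a v → T.Lifts c (σ a) (σ v) := by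
  classical
  have hT := T.isTree
  let d : W → ℕ := T.tree.dist x
  let d' : W → ℕ := T.tree.dist x'
  have hpar : ∀ w, ∃ p, w ≠ x → T.tree.Adj p w ∧ d w = d p + 1 ∧
      ∀ q, T.tree.Adj q w → d w = d q + 1 → q = p := fun w => by
    by_cases hw : w = x
    · exact ⟨w, fun h => absurd hw h⟩
    · obtain ⟨p, hp⟩ := exists_parent hT x w hw
      exact ⟨p, fun _ => hp⟩
  choose par hpar using hpar
  have hstar : ∀ w w' u u', ∃ f : W → W, T.proj w = T.proj w' →
      (∃ e, T.Lifts e w u ∧ T.Lifts e w' u') →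
      Set.BijOn f {v | T.tree.Adj w v} {v | T.tree.Adj w' v} ∧ f u = u' ∧
        ∀ v c, T.Lifts c w v → T.Lifts c w' (f v) := fun w w' u u' => by
    by_cases h : T.proj w = T.proj w' ∧ ∃ e, T.Lifts e w u ∧ T.Lifts e w' u'
    · obtain ⟨f, hf⟩ := exists_star_bijOn w w' u u' h.1 h.2
      exact ⟨f, fun _ _ => hf⟩
    · exact ⟨id, fun h1 h2 => absurd ⟨h1, h2⟩ h⟩
  choose F hF using hstar
  let σ : W → W := fun w => propagate F par x x' y y' (d w) w
  have hd0 : ∀ w, d w = 0 ↔ w = x := fun w => by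
    rw [eq_comm (a := w)]
    exact hT.connected.dist_eq_zero_iff
  have hd0' : ∀ w, d' w = 0 ↔ w = x' := fun w => by
    rw [eq_comm (a := w)]
    exact hT.connected.dist_eq_zero_iff
  have hσx : σ x = x' := by
    change propagate F par x x' y y' (d x) x = x'
    rw [(hd0 x).2 rfl, propagate]
  -- `back a` is the neighbour of `a` whose image `im a` is known before that of the others
  let back : W → W := fun a => if a = x then y else par a
  let im : W → W := fun a => if a = x then y' else σ (par a)
  let f : W → W → W := fun a => F a (σ a) (back a) (im a)
  have hσ : ∀ w, w ≠ x → σ w = f (par w) w := by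
    intro w hw
    obtain ⟨-, h2, -⟩ := hpar w hw
    change propagate F par x x' y y' (d w) w = F (par w) (σ (par w)) (back (par w)) (im (par w)) w
    by_cases hp : par w = x
    · rw [h2, hp, (hd0 x).2 rfl, hσx, propagate]
      simp [back, im]
    · obtain ⟨-, h2', -⟩ := hpar _ hp
      simp only [back, im, if_neg hp]
      rw [h2, h2', propagate]
      change _ = F (par w) (propagate F par x x' y y' (d (par w)) (par w)) (par (par w)) _ w
      rw [h2']
  have inv : ∀ n a, d a = n → T.proj a = T.proj (σ a) ∧ d' (σ a) = d a ∧
      ∃ e, T.Lifts e a (back a) ∧ T.Lifts e (σ a) (im a) := by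
    intro n
    induction n using Nat.strong_induction_on with
    | _ n ih =>
      intro a ha
      by_cases hax : a = x
      · subst hax
        rw [hσx]
        refine ⟨hx, by rw [(hd0 a).2 rfl, (hd0' x').2 rfl], e, ?_⟩
        simp only [back, im, if_true]
        exact ⟨hxy, hxy'⟩
      · obtain ⟨h1, h2, -⟩ := hpar a hax
        obtain ⟨i1, i2, i3⟩ := ih (d (par a)) (by omega) (par a) rfl
        obtain ⟨f1, f2, f3⟩ := hF _ _ _ _ i1 i3
        obtain ⟨c, hc⟩ := exists_lifts h1
        have hc' : T.Lifts c (σ (par a)) (σ a) := by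
          rw [hσ a hax]
          exact f3 a c hc
        refine ⟨hc.proj_eq hc' i1, ?_, c, ?_⟩
        · rcases hT.dist_eq_dist_add_one_of_adj x' hc'.adj with h | h
          -- if `σ a` were closer to `x'` than `σ (par a)`, then it would be the parent of
          -- `σ (par a)`, which is the image of the parent of `par a`
          · exfalso
            change d' (σ (par a)) = d' (σ a) + 1 at h
            by_cases hp : par a = x
            · rw [hp, (hd0 x).2 rfl] at i2
              rw [hp, i2] at h
              omega
            · obtain ⟨h1', h2', -⟩ := hpar _ hp
              obtain ⟨-, j2, -⟩ := ih (d (par (par a))) (by omega) (par (par a)) rfl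
              have hne : σ (par a) ≠ x' := by
                rw [Ne, ← hd0', i2]
                omega
              obtain ⟨q, -, -, hq⟩ := exists_parent hT x' (σ (par a)) hne
              have e1 : σ a = q := hq _ hc'.adj.symm h
              have hback : back (par a) = par (par a) := if_neg hp
              have him : im (par a) = σ (par (par a)) := if_neg hp
              obtain ⟨b, -, hb'⟩ := i3
              rw [him] at hb'
              have e2 : σ (par (par a)) = q := hq _ hb'.adj.symm (by
                change d' _ = d' _ + 1
                omega)
              have e3 : a = back (par a) := by
                apply f1.injOn h1
                · rw [hback]
                  exact h1'.symm
                · exact ((hσ a hax).symm.trans e1).trans (f2.trans (him.trans e2)).symm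
              have : d a = d (par (par a)) := congrArg d (e3.trans hback)
              omega
          · change d' (σ a) = d' (σ (par a)) + 1 at h
            omega
        · simp only [back, im, if_neg hax]
          exact ⟨hc.symm, hc'.symm⟩
  have hf : ∀ a, Set.BijOn (f a) {v | T.tree.Adj a v} {v | T.tree.Adj (σ a) v} ∧
      f a (back a) = im a ∧ ∀ v c, T.Lifts c a v → T.Lifts c (σ a) (f a v) := fun a =>
    hF _ _ _ _ (inv _ a rfl).1 (inv _ a rfl).2.2
  have hσf : ∀ a, Set.EqOn (f a) σ {v | T.tree.Adj a v} := by
    intro a v hv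
    rcases hT.dist_eq_dist_add_one_of_adj x hv with h | h
    · have hax : a ≠ x := by
        rw [Ne, ← hd0]
        change d a = d v + 1 at h
        omega
      have hva := (hpar a hax).2.2 v hv.symm h
      have hb : back a = v := (if_neg hax).trans hva.symm
      have hi : im a = σ v := (if_neg hax).trans (by rw [← hva])
      rw [← hi, ← (hf a).2.1, hb]
    · have hvx : v ≠ x := by
        rw [Ne, ← hd0]
        change d v = d a + 1 at h
        omega
      rw [hσ v hvx, ← (hpar v hvx).2.2 a hv h]
  have hbij : ∀ a, Set.BijOn σ {v | T.tree.Adj a v} {v | T.tree.Adj (σ a) v} := fun a =>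
    (hf a).1.congr (hσf a)
  have hlift : ∀ a v c, T.Lifts c a v → T.Lifts c (σ a) (σ v) := fun a v c h => by
    rw [← hσf a h.adj]
    exact (hf a).2.2 v c h
  refine ⟨σ, ?_, hσx, ?_, fun a => (inv _ a rfl).1, hbij, hlift⟩
  · have : ∀ n a b, d a = n → σ a = σ b → a = b := by
      intro n
      induction n with
      | zero =>
        intro a b ha hab
        have hb := (inv _ b rfl).2.1
        rw [← hab, (inv _ a rfl).2.1, ha] at hb
        rw [(hd0 a).1 ha, (hd0 b).1 hb.symm]
      | succ n ih =>
        intro a b ha hab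
        have hb := (inv _ b rfl).2.1
        rw [← hab, (inv _ a rfl).2.1, ha] at hb
        have hax : a ≠ x := by
          rw [Ne, ← hd0]
          omega
        have hbx : b ≠ x := by
          rw [Ne, ← hd0]
          omega
        obtain ⟨a1, a2, -⟩ := hpar a hax
        obtain ⟨b1, b2, -⟩ := hpar b hbx
        have ha' := (inv _ a rfl).2.1
        have hne : σ a ≠ x' := by
          rw [Ne, ← hd0']
          omega
        obtain ⟨q, -, -, hq⟩ := exists_parent hT x' (σ a) hne
        have h1 : σ (par a) = q := hq _ ((hbij _).mapsTo a1) (by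
          have := (inv _ (par a) rfl).2.1
          change d' _ = d' _ + 1
          omega)
        have h2 : σ (par b) = q := hq _ (by rw [hab]; exact (hbij _).mapsTo b1) (by
          have := (inv _ (par b) rfl).2.1
          change d' _ = d' _ + 1
          omega)
        have h3 : par a = par b := ih _ _ (by omega) (h1.trans h2.symm)
        exact (hbij (par a)).injOn a1 (by rw [h3]; exact b1) hab
    exact fun a b => this _ a b rfl
  · have := (hf x).2.1
    have hb : back x = y := if_pos rfl
    have hi : im x = y' := if_pos rfl
    rw [hb, hi, hσf x hxy.adj] at this
    exact this

variable {J : JacobiParameters G} {hG : IsFiniteLeafless G}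

/-! ### Symmetries of the Jacobi matrix -/

theorem adj_of_jacobiMatrix_ne_zero (hb : ∀ j, J.b (T.proj j) = 0) {x y : W}
    (h : (T.jacobiMatrix J x y : ℂ) ≠ 0) : T.tree.Adj x y := by
  by_contra hxy
  apply h
  unfold jacobiMatrix
  split_ifs with h1
  · simp [hb]
  · simp

theorem jacobiMatrix_map {σ : W → W} (hσ : Function.Injective σ)
    (hproj : ∀ a, T.proj a = T.proj (σ a))
    (hbij : ∀ a, Set.BijOn σ {v | T.tree.Adj a v} {v | T.tree.Adj (σ a) v})
    (hlift : ∀ a v c, T.Lifts c a v → T.Lifts c (σ a) (σ v)) (x y : W) :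
    T.jacobiMatrix J (σ x) (σ y) = T.jacobiMatrix J x y := by
  unfold jacobiMatrix
  by_cases hxy : x = y
  · subst hxy
    simp [hproj x]
  · rw [if_neg hxy, if_neg (hσ.ne hxy)]
    by_cases h : T.tree.Adj x y
    · obtain ⟨h', he⟩ := hlift x y _ ⟨h, rfl⟩
      rw [dif_pos h, dif_pos h', he]
    · rw [dif_neg h, dif_neg]
      intro h'
      obtain ⟨v, hv, hvy⟩ := (hbij x).surjOn h'
      exact h (hσ hvy ▸ hv)

theorem inner_jacobiOperator (φ ψ : lp (fun _ : W => ℂ) 2) :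
    inner ℂ (T.jacobiOperator J hG φ) ψ = inner ℂ φ (T.jacobiOperator J hG ψ) := by
  classical
  suffices h : ContinuousLinearMap.adjoint (T.jacobiOperator J hG) = T.jacobiOperator J hG by
    rw [← ContinuousLinearMap.adjoint_inner_right, h]
  ext χ x
  have h1 := ContinuousLinearMap.adjoint_inner_right (T.jacobiOperator J hG)
    (lp.single 2 x (1 : ℂ)) χ
  rw [lp.inner_single_left, lp.inner_eq_tsum] at h1
  simp only [RCLike.inner_apply, map_one, mul_one] at h1
  rw [h1, jacobiOperator_apply]
  refine tsum_congr fun y => ?_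
  rw [jacobiOperator_apply, tsum_eq_single x]
  · rw [lp.single_apply_self, mul_one, Complex.conj_ofReal, T.jacobiMatrix_comm, mul_comm]
  · intro z hz
    rw [lp.single_apply_ne _ _ _ hz, mul_zero]

theorem exists_lp_mul (g : lp (fun _ : W => ℂ) 2) (m : W → ℂ) (hm : ∀ w, ‖m w‖ ≤ 1) :
    ∃ ψ : lp (fun _ : W => ℂ) 2, ∀ w, ψ w = m w * g w := by
  refine ⟨⟨fun w => m w * g w, (lp.memℓp g).mono' fun w => ?_⟩, fun w => rfl⟩
  rw [norm_mul]
  exact mul_le_of_le_one_left (norm_nonneg _) (hm w)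

theorem exists_lp_comp (g : lp (fun _ : W => ℂ) 2) {σ : W → W} (hσ : Function.Injective σ) :
    ∃ ψ : lp (fun _ : W => ℂ) 2, ∀ w, ψ w = g (σ w) :=
  ⟨⟨fun w => g (σ w), memℓp_gen (((memℓp_gen_iff (by norm_num)).1 (lp.memℓp g)).comp_injective hσ)⟩,
    fun _ => rfl⟩

/-! ### Columns of the inverse -/

variable (T J hG) in
open Classical in
/-- `g` is the column at `x` of the inverse of the Jacobi matrix: a square-summable solution of
`H g = δ_x`. -/
def IsGreenVector (x : W) (g : lp (fun _ : W => ℂ) 2) : Prop :=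
  T.jacobiOperator J hG g = lp.single 2 x (1 : ℂ)

theorem IsGreenVector.tsum_self {x : W} {g : lp (fun _ : W => ℂ) 2}
    (hg : T.IsGreenVector J hG x g) : ∑' y, (T.jacobiMatrix J x y : ℂ) * g y = 1 := by
  classical
  rw [← jacobiOperator_apply T J hG, show T.jacobiOperator J hG g = _ from hg,
    lp.single_apply_self]

theorem IsGreenVector.tsum_of_ne {x z : W} {g : lp (fun _ : W => ℂ) 2}
    (hg : T.IsGreenVector J hG x g) (hz : z ≠ x) :
    ∑' y, (T.jacobiMatrix J z y : ℂ) * g y = 0 := by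
  classical
  rw [← jacobiOperator_apply T J hG, show T.jacobiOperator J hG g = _ from hg,
    lp.single_apply_ne _ _ _ hz]

/-- Changing the sign of `φ` on one class of the bipartition of the tree changes the sign of
`H φ` on the other, so the column at `x` of the inverse lives on the class opposite to `x`. -/
theorem IsGreenVector.apply_self (hb : ∀ j, J.b (T.proj j) = 0)
    (hinj : Function.Injective (T.jacobiOperator J hG)) {x : W} {g : lp (fun _ : W => ℂ) 2}
    (hg : T.IsGreenVector J hG x g) : g x = 0 := by
  classical
  obtain ⟨c⟩ := T.isTree.colorable_two
  let s : W → ℂ := fun w => if c w = c x then 1 else -1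
  have hs : ∀ w u, T.tree.Adj w u → s u = -s w := by
    intro w u h
    have h1 := c.valid h
    simp only [s]
    split_ifs with h2 h3 h3
    · exact absurd (h3.trans h2.symm) h1
    · simp
    · simp
    · exfalso
      omega
  obtain ⟨ψ, hψ⟩ := exists_lp_mul g s fun w => by
    simp only [s]
    split_ifs <;> simp
  have h : T.jacobiOperator J hG ψ = T.jacobiOperator J hG (-g) := by
    rw [map_neg]
    ext w
    rw [lp.coeFn_neg, Pi.neg_apply, jacobiOperator_apply]
    have h1 : ∑' y, (T.jacobiMatrix J w y : ℂ) * ψ y =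
        -s w * ∑' y, (T.jacobiMatrix J w y : ℂ) * g y := by
      rw [← tsum_mul_left]
      refine tsum_congr fun y => ?_
      by_cases h0 : (T.jacobiMatrix J w y : ℂ) = 0
      · simp [h0]
      · rw [hψ, hs w y (adj_of_jacobiMatrix_ne_zero hb h0)]
        ring
    rw [h1, jacobiOperator_apply]
    by_cases hw : w = x
    · subst hw
      simp [s]
    · rw [hg.tsum_of_ne hw]
      simp
  have h2 := congrArg (fun φ : lp (fun _ : W => ℂ) 2 => φ x) (hinj h)
  simp only [lp.coeFn_neg, Pi.neg_apply, hψ, s, if_true, one_mul] at h2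
  exact self_eq_neg.1 h2

theorem IsGreenVector.exists_adj (hb : ∀ j, J.b (T.proj j) = 0) {x : W}
    {g : lp (fun _ : W => ℂ) 2} (hg : T.IsGreenVector J hG x g) :
    ∃ y, T.tree.Adj x y ∧ g y ≠ 0 := by
  by_contra! h
  have h1 := hg.tsum_self
  rw [tsum_congr (g := fun _ => (0 : ℂ)), tsum_zero] at h1
  · exact zero_ne_one h1
  · intro y
    by_cases h0 : (T.jacobiMatrix J x y : ℂ) = 0
    · rw [h0, zero_mul]
    · rw [h y (adj_of_jacobiMatrix_ne_zero hb h0), mul_zero]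

/-- There is at most one neighbour of `x` at which the column at `x` of the inverse is nonzero.
Cutting it off to the branch of the tree beyond such a neighbour `y` gives a solution of
`H φ = c δ_x`, because the column vanishes at `x`; so the whole column lives on that branch. -/
theorem IsGreenVector.adj_unique (hb : ∀ j, J.b (T.proj j) = 0)
    (hinj : Function.Injective (T.jacobiOperator J hG)) {x y y' : W}
    {g : lp (fun _ : W => ℂ) 2} (hg : T.IsGreenVector J hG x g)
    (hy : T.tree.Adj x y) (hgy : g y ≠ 0) (hy' : T.tree.Adj x y') (hgy' : g y' ≠ 0) :
    y = y' := by
  classical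
  have hgx := hg.apply_self hb hinj
  let t := T.tree.deleteEdges {s(x, y)}
  let S : Set W := {w | t.Reachable y w}
  have hyS : y ∈ S := SimpleGraph.Reachable.refl y
  have hxS : x ∉ S := fun h =>
    SimpleGraph.isBridge_iff.1
      (SimpleGraph.isAcyclic_iff_forall_adj_isBridge.1 T.isTree.isAcyclic hy) h.symm
  have hS : ∀ w u, T.tree.Adj w u → w ∈ S → u ∉ S → w = y ∧ u = x := by
    intro w u hwu hw hu
    by_cases h : s(w, u) = s(x, y)
    · rcases Sym2.eq_iff.1 h with ⟨rfl, -⟩ | h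
      · exact absurd hw hxS
      · exact h
    · exact absurd (hw.trans (SimpleGraph.Adj.reachable
        (SimpleGraph.deleteEdges_adj.2 ⟨hwu, by simpa using h⟩))) hu
  obtain ⟨ψ, hψ⟩ := exists_lp_mul g (S.indicator 1) fun w => by
    by_cases h : w ∈ S <;> simp [h]
  have hψS : ∀ w ∈ S, ψ w = g w := fun w hw => by simp [hψ, hw]
  have hψS' : ∀ w, w ∉ S → ψ w = 0 := fun w hw => by simp [hψ, hw]
  -- `k` is forced by the value of `H ψ` at `x`, where only the neighbour `y` contributes
  let k : ℂ := T.jacobiMatrix J x y * g y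
  have h : T.jacobiOperator J hG ψ = T.jacobiOperator J hG (k • g) := by
    rw [map_smul]
    ext w
    rw [lp.coeFn_smul, Pi.smul_apply, jacobiOperator_apply, jacobiOperator_apply, smul_eq_mul]
    by_cases hwS : w ∈ S
    · have hwx : w ≠ x := fun h => hxS (h ▸ hwS)
      rw [hg.tsum_of_ne hwx, mul_zero, ← hg.tsum_of_ne hwx]
      refine tsum_congr fun u => ?_
      by_cases h0 : (T.jacobiMatrix J w u : ℂ) = 0
      · rw [h0, zero_mul, zero_mul]
      · by_cases hu : u ∈ S
        · rw [hψS u hu]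
        · rw [hψS' u hu, (hS w u (adj_of_jacobiMatrix_ne_zero hb h0) hwS hu).2, hgx]
    · have hterm : ∀ u, (T.jacobiMatrix J w u : ℂ) * ψ u ≠ 0 → u = y ∧ w = x := by
        intro u hu
        refine hS u w (adj_of_jacobiMatrix_ne_zero hb (left_ne_zero_of_mul hu)).symm ?_ hwS
        by_contra hu'
        exact right_ne_zero_of_mul hu (hψS' u hu')
      rw [tsum_eq_single y fun u hu => by_contra fun h0 => hu (hterm u h0).1]
      by_cases hwx : w = x
      · rw [hwx, hg.tsum_self, mul_one, hψS y hyS]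
      · rw [hg.tsum_of_ne hwx, mul_zero]
        exact by_contra fun h0 => hwx (hterm y h0).2
  have hφ : ∀ w, ψ w = k * g w := fun w => by
    rw [hinj h, lp.coeFn_smul, Pi.smul_apply, smul_eq_mul]
  have hk1 : k ≠ 0 := left_ne_zero_of_mul (a := k) (b := g y) (by
    rw [← hφ, hψS y hyS]
    exact hgy)
  have hy'S : y' ∈ S := by
    by_contra hn
    have := hφ y'
    rw [hψS' y' hn] at this
    exact mul_ne_zero hk1 hgy' this.symm
  exact (hS y' x hy'.symm hy'S hxS).1.symm

theorem IsGreenVector.apply_ne_zero_symm {x y : W} {g g' : lp (fun _ : W => ℂ) 2}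
    (hg : T.IsGreenVector J hG x g) (hg' : T.IsGreenVector J hG y g') (h : g y ≠ 0) :
    g' x ≠ 0 := by
  classical
  have h1 := inner_jacobiOperator (T := T) (J := J) (hG := hG) g g'
  rw [show T.jacobiOperator J hG g = _ from hg, show T.jacobiOperator J hG g' = _ from hg',
    lp.inner_single_left, lp.inner_single_right] at h1
  simp only [RCLike.inner_apply, map_one, mul_one, one_mul] at h1
  rw [h1]
  simpa using h

/-- Whether the column at `x` of the inverse vanishes at a neighbour `y` depends only on the label
of the directed edge from `x` to `y`. -/
theorem IsGreenVector.apply_ne_zero_of_lifts (hb : ∀ j, J.b (T.proj j) = 0)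
    (hinj : Function.Injective (T.jacobiOperator J hG)) {e : E} {x y x' y' : W}
    {g g' : lp (fun _ : W => ℂ) 2} (hg : T.IsGreenVector J hG x g)
    (hg' : T.IsGreenVector J hG x' g') (hx : T.proj x = T.proj x') (hxy : T.Lifts e x y)
    (hxy' : T.Lifts e x' y') (h : g y ≠ 0) : g' y' ≠ 0 := by
  obtain ⟨σ, hσ, hσx, hσy, hproj, hbij, hlift⟩ := exists_automorphism hx hxy hxy'
  obtain ⟨ψ, hψ⟩ := exists_lp_comp g' hσ
  have key : T.jacobiOperator J hG ψ = T.jacobiOperator J hG g := by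
    ext w
    rw [jacobiOperator_apply, jacobiOperator_apply]
    have h1 : ∑' u, (T.jacobiMatrix J w u : ℂ) * ψ u =
        ∑' u, (T.jacobiMatrix J (σ w) u : ℂ) * g' u := by
      rw [← hσ.tsum_eq (f := fun u => (T.jacobiMatrix J (σ w) u : ℂ) * g' u)]
      · refine tsum_congr fun u => ?_
        rw [hψ, jacobiMatrix_map hσ hproj hbij hlift]
      · intro u hu
        obtain ⟨v, -, hv⟩ := (hbij w).surjOn
          (adj_of_jacobiMatrix_ne_zero hb (left_ne_zero_of_mul hu))
        exact ⟨v, hv⟩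
    rw [h1]
    by_cases hw : w = x
    · rw [hw, hσx, hg.tsum_self, hg'.tsum_self]
    · rw [hg.tsum_of_ne hw, hg'.tsum_of_ne (fun h => hw (hσ (h.trans hσx.symm)))]
  rw [← hσy, ← hψ, hinj key]
  exact h

/-! ### The perfect matching of the base graph -/

theorem exists_lifts_of_isLink {x : W} {e : E} {v : V} (h : G.IsLink e (T.proj x) v) :
    ∃ y, T.Lifts e x y ∧ T.proj y = v := by
  have h1 : {y | T.Lifts e x y}.encard ≠ 0 := by
    rw [encard_setOf_lifts x h.edge_mem]
    unfold endMult
    split_ifs with h2 h3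
    · simp
    · simp
    · exact absurd h.inc_left h3
  obtain ⟨y, hy⟩ := Set.nonempty_iff_ne_empty.2 (mt Set.encard_eq_zero.2 h1)
  exact ⟨y, hy, (h.right_unique hy.isLink).symm⟩

theorem exists_proj_eq (hG : IsFiniteLeafless G) {v : V} (hv : v ∈ V(G)) :
    ∃ x, T.proj x = v := by
  obtain ⟨x₀⟩ := T.isTree.connected.nonempty
  induction hG.connected _ (T.proj_mem x₀) v hv with
  | refl => exact ⟨x₀, rfl⟩
  | tail _ h ih =>
    obtain ⟨x, rfl⟩ := ih h.left_mem
    obtain ⟨e, he⟩ := h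
    obtain ⟨y, -, hy⟩ := exists_lifts_of_isLink he
    exact ⟨y, hy⟩

/-- Over a loop, a vertex of the tree has two neighbours. -/
theorem exists_lifts_ne {e : E} {x : W} (h : G.IsLoopAt e (T.proj x)) :
    ∃ y z, T.Lifts e x y ∧ T.Lifts e x z ∧ y ≠ z := by
  have h1 := encard_setOf_lifts (T := T) x h.edge_mem
  rw [endMult, if_pos h] at h1
  obtain ⟨y, z, hyz, hs⟩ := Set.encard_eq_two.1 h1
  exact ⟨y, z, hs.ge (Set.mem_insert _ _), hs.ge (Set.mem_insert_of_mem _ rfl), hyz⟩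

/-- If the Jacobi matrix with zero diagonal is invertible, then the edges of the tree at which the
inverse does not vanish project to a perfect matching of the base graph, so that the number of
vertices of the base graph is even. -/
theorem even_ncard_of_isUnit (hb : ∀ j, J.b (T.proj j) = 0)
    (hH : IsUnit (T.jacobiOperator J hG)) : Even V(G).ncard := by
  classical
  obtain ⟨⟨A, R, hAR, hRA⟩, rfl : A = _⟩ := hH
  have hinj : Function.Injective (T.jacobiOperator J hG) :=
    Function.LeftInverse.injective (g := R) fun φ => DFunLike.congr_fun hRA φ
  let g : W → lp (fun _ : W => ℂ) 2 := fun x => R (lp.single 2 x (1 : ℂ))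
  have hg : ∀ x, T.IsGreenVector J hG x (g x) := fun x => by
    change (T.jacobiOperator J hG * R) (lp.single 2 x (1 : ℂ)) = lp.single 2 x (1 : ℂ)
    rw [hAR, one_apply_eq_self]
  choose m hmadj hmg using fun x => (hg x).exists_adj hb
  have huniq : ∀ {x y}, T.tree.Adj x y → g x y ≠ 0 → m x = y := fun h h' =>
    (hg _).adj_unique hb hinj (hmadj _) (hmg _) h h'
  have hmm : ∀ x, m (m x) = x := fun x =>
    huniq (hmadj x).symm ((hg x).apply_ne_zero_symm (hg (m x)) (hmg x))
  have hmlab : ∀ {x x' y' e}, T.proj x = T.proj x' → T.Lifts e x (m x) → T.Lifts e x' y' →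
      m x' = y' := fun hp h h' =>
    huniq h'.adj ((hg _).apply_ne_zero_of_lifts hb hinj (hg _) hp h h' (hmg _))
  have hmproj : ∀ {x x'}, T.proj x = T.proj x' → T.proj (m x) = T.proj (m x') := by
    intro x x' hp
    obtain ⟨e, he⟩ := exists_lifts (hmadj x)
    obtain ⟨y', hy', hy''⟩ := exists_lifts_of_isLink (x := x') (hp ▸ he.isLink)
    rw [hmlab hp he hy', hy'']
  have hmne : ∀ x, T.proj (m x) ≠ T.proj x := by
    intro x hp
    obtain ⟨e, he⟩ := exists_lifts (hmadj x)
    have hloop : G.IsLoopAt e (T.proj x) := by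
      have := he.isLink
      rwa [hp] at this
    obtain ⟨y, z, hy, hz, hyz⟩ := exists_lifts_ne hloop
    exact hyz ((hmlab rfl he hy).symm.trans (hmlab rfl he hz))
  have : Nonempty W := T.isTree.connected.nonempty
  choose! r hr using fun v (hv : v ∈ V(G)) => exists_proj_eq (T := T) hG hv
  rw [Set.ncard_eq_toFinset_card _ hG.finite_vertexSet, ← ZMod.natCast_eq_zero_iff_even,
    ← nsmul_one, ← Finset.sum_const]
  refine Finset.sum_involution (fun v _ => T.proj (m (r v))) (fun _ _ => by decide) ?_ ?_ ?_
  · intro v hv _ h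
    exact hmne (r v) (h.trans (hr v (hG.finite_vertexSet.mem_toFinset.1 hv)).symm)
  · intro v _
    exact hG.finite_vertexSet.mem_toFinset.2 (T.proj_mem _)
  · intro v hv
    rw [hmproj (hr _ (T.proj_mem (m (r v)))), hmm]
    exact hr v (hG.finite_vertexSet.mem_toFinset.1 hv)

end UniversalCover

end PeriodicTree

theorem theorem5p2 {V E W : Type*} (G : Graph V E) (hG : PeriodicTree.IsFiniteLeafless G)
    (T : PeriodicTree.UniversalCover G W) (J : PeriodicTree.JacobiParameters G)
    (hodd : Odd V(G).ncard) (hb : ∀ j : W, J.b (T.proj j) = 0) :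
    (0 : ℂ) ∈ spectrum ℂ (T.jacobiOperator J hG) := by
  by_contra h
  exact Nat.not_even_iff_odd.2 hodd
    (PeriodicTree.UniversalCover.even_ncard_of_isUnit hb (spectrum.zero_notMem_iff ℂ |>.1 h))
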